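/- Let $G_m(\mathbb C^{n+m})$ be the Grassmannian of complex $m$-planes in $\mathbb C^{n+m}$ with its standard Hermitian inner product, $\mathcal U$ the tautological bundle and $\mathcal U^{\perp}$ its orthogonal complement, with induced Hermitian metrics $g_1$ on $\mathcal U^*$ and $g_2$ on $\mathcal U^\perp$. Identify the holomorphic tangent bundle with $\mathrm{Hom}(\mathcal U,\mathcal U^\perp)=\mathcal U^*\otimes\mathcal U^\perp$ (the velocity of a curve $U(t)$ of planes sends $u(0)$ to the orthogonal projection of $u'(0)$ to $U(0)^\perp$, for $u(t)\in U(t)$), and let $g=g_1\cdot g_2$ be the Fubini–Study metric. Here, for sesquilinear forms $P_1$ on $\mathcal U^*$ and $P_2$ on $\mathcal U^\perp$, $P_1\cdot P_2$ is the form on $\mathcal U^*\otimes\mathcal U^\perp$ with $(P_1\cdot P_2)(\alpha\otimes q,\beta\otimes r)=P_1(\alpha,\beta)P_2(q,r)$; a Hermitian form $h$ on the holomorphic tangent bundle is regarded as the real symmetric $2$-tensor $2\,\mathrm{Re}\,h$, that is, $h_{I\bar J}$ are the components of the complexified real tensor on $\partial/\partial w_I$, $\partial/\partial\bar w_J$ in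 holomorphic coordinates $w_I$. Let $\gamma$ be a trace-free Hermitian $(n+m)\times(n+m)$ matrix and $P_\gamma(v_1,v_2)=v_2^*\gamma v_1$. Let $f_\gamma(U)=\sum_{i=1}^m P_\gamma(\eta_i,\eta_i)$ for any orthonormal basis $\eta_1,\dots,\eta_m$ of $U$. Let $P_\gamma^{\perp}$ be the restriction of $P_\gamma$ to $\mathcal U^\perp$, and $P_\gamma^{*}$ the form on $\mathcal U^*$ given by $P_\gamma^*(\alpha,\beta)=P_\gamma(b,a)$, where $a,b\in\mathcal U$ represent $\alpha,\beta$, i.e. $\alpha(u)=a^*u$, $\beta(u)=b^*u$. Put $$h_1=g_1\cdot P_\gamma^{\perp},\qquad h_2=P_\gamma^{*}\cdot g_2 .$$ Then the Hessian of $f_\gamma$ with respect to the Levi-Civita connection of the Fubini–Study metric is, on all of $G_m(\mathbb C^{n+m})$, $$\mathrm{Hess}(f_\gamma)=h_1-h_2 .$$ -/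

import Mathlib

noncomputable section

namespace GrassmannHessian

/-! ### Riemannian Hessian in a chart

`E` is a real vector space (the range of a chart), `G x X Y` the value at the point `x` of a
Riemannian metric on the constant vector fields `X`, `Y`, and `lineDeriv ℝ F x X` is the derivative
of `F` at `x` in the direction `X`. -/

section Hessian

variable {E : Type*} [AddCommGroup E] [Module ℝ E]

/-- The right-hand side of Koszul's formula for `g(∇_X Y, Z)`, with `X, Y, Z` constant (hence
commuting) vector fields: the Christoffel symbol of the first kind. -/
def koszul (G : E → E → E → ℝ) (x X Y Z : E) : ℝ :=
  (1 / 2) * (lineDeriv ℝ (fun y => G y Y Z) x X + lineDeriv ℝ (fun y => G y X Z) x Y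
    - lineDeriv ℝ (fun y => G y X Y) x Z)

/-- The Levi-Civita derivative `∇_X Y` at `x` of the constant field `Y` along the constant field
`X`: the vector `N` with `G x N Z = koszul G x X Y Z` for all `Z` (it is unique when `G x` is
an inner product, and exists when moreover `G` is smooth and `E` is finite-dimensional). -/
def leviCivita (G : E → E → E → ℝ) (x X Y : E) : E :=
  Classical.epsilon fun N => ∀ Z, G x N Z = koszul G x X Y Z

/-- The Hessian `(∇² f)(X, Y) = X (Y f) - (∇_X Y) f` of the metric `G` at `x`. -/
def hessian (G : E → E → E → ℝ) (f : E → ℝ) (x X Y : E) : ℝ :=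
  lineDeriv ℝ (fun y => lineDeriv ℝ f y Y) x X - lineDeriv ℝ f x (leviCivita G x X Y)

end Hessian

/-! ### The Grassmannian, its tautological bundles and its tangent bundle -/

/-- `ℂ^{n+m}` with the standard Hermitian inner product. -/
abbrev Amb (m n : ℕ) : Type := EuclideanSpace ℂ (Fin (n + m))

/-- The Grassmannian `G_m(ℂ^{n+m})` of `m`-planes in `ℂ^{n+m}`. -/
def Gr (m n : ℕ) : Type := {U : Submodule ℂ (Amb m n) // Module.finrank ℂ U = m}

variable {m n : ℕ}

/-- The fibre at `U` of the tautological bundle. -/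
abbrev Gr.taut (U : Gr m n) : Submodule ℂ (Amb m n) := U.1

/-- The fibre at `U` of the orthogonal complement of the tautological bundle. -/
abbrev Gr.perp (U : Gr m n) : Submodule ℂ (Amb m n) := U.1ᗮ

/-- The tangent space `T_U G_m(ℂ^{n+m}) = Hom_ℂ(U, U^⊥) = U^* ⊗ U^⊥`: the velocity of a curve `U(t)`
sends `u(0)` to the orthogonal projection of `u'(0)` to `U(0)^⊥`, for `u(t) ∈ U(t)`. -/
abbrev Gr.tangent (U : Gr m n) : Type := U.taut →ₗ[ℂ] U.perp

/-! ### Charts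

For each orthonormal basis `b` of `ℂ^{n+m}` the planes that are graphs over the span of the first
`m` vectors of `b` are parametrized by the `n × m` complex matrices `W`. -/

/-- The frame `c_1, …, c_m` of the tautological bundle in the chart of the basis `b`:
the columns of the block matrix `(I ; W)` with respect to `b`. -/
def frame (b : OrthonormalBasis (Fin m ⊕ Fin n) ℂ (Amb m n)) (W : Matrix (Fin n) (Fin m) ℂ)
    (j : Fin m) : Amb m n :=
  b (Sum.inl j) + ∑ i, W i j • b (Sum.inr i)

theorem inner_frame (b : OrthonormalBasis (Fin m ⊕ Fin n) ℂ (Amb m n))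
    (W : Matrix (Fin n) (Fin m) ℂ) (k j : Fin m) :
    inner ℂ (b (Sum.inl k)) (frame b W j) = if k = j then 1 else 0 := by
  rw [frame, inner_add_right, inner_sum]
  simp [inner_smul_right, b.inner_eq_ite]

theorem linearIndependent_frame (b : OrthonormalBasis (Fin m ⊕ Fin n) ℂ (Amb m n))
    (W : Matrix (Fin n) (Fin m) ℂ) : LinearIndependent ℂ (frame b W) := by
  rw [Fintype.linearIndependent_iff]
  intro a ha k
  have h := congrArg (fun v => inner ℂ (b (Sum.inl k)) v) ha
  simpa [inner_sum, inner_smul_right, inner_frame] using h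

/-- The `m`-plane with coordinates `W` in the chart of the orthonormal basis `b`. -/
def chart (b : OrthonormalBasis (Fin m ⊕ Fin n) ℂ (Amb m n)) (W : Matrix (Fin n) (Fin m) ℂ) :
    Gr m n :=
  ⟨Submodule.span ℂ (Set.range (frame b W)), by
    rw [finrank_span_eq_card (linearIndependent_frame b W), Fintype.card_fin]⟩

/-- The charts cover the Grassmannian: every plane is the centre of one of them. -/
theorem exists_chart_zero (U : Gr m n) :
    ∃ b : OrthonormalBasis (Fin m ⊕ Fin n) ℂ (Amb m n), chart b 0 = U := by
  let η := (stdOrthonormalBasis ℂ U.taut).reindex (finCongr U.2)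
  let v : Fin m ⊕ Fin n → Amb m n := Sum.elim (fun j => (η j : Amb m n)) 0
  have hv : Orthonormal ℂ ((Set.range Sum.inl).domRestrict v) := by
    refine ⟨?_, ?_⟩
    · rintro ⟨_, i, rfl⟩
      exact η.orthonormal.1 i
    · rintro ⟨_, i, rfl⟩ ⟨_, j, rfl⟩ hij
      exact η.orthonormal.2 fun h => hij (by subst h; rfl)
  obtain ⟨b, hb⟩ := hv.exists_orthonormalBasis_extension_of_card_eq
    (by simp [add_comm])
  refine ⟨b, Subtype.ext ?_⟩
  have hf : frame b 0 = fun j => U.taut.subtype (η j) := by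
    funext j
    simp [frame, hb (Sum.inl j) ⟨j, rfl⟩, v]
  have : Submodule.span ℂ (Set.range η) = ⊤ := by
    simpa using η.toBasis.span_eq
  change Submodule.span ℂ (Set.range (frame b 0)) = U.1
  rw [hf, Set.range_comp' U.taut.subtype η, Submodule.span_image, this]
  simp

/-- The tangent vector at `chart b W` with coordinates `X`, i.e. `∑ X_{ij} ∂/∂w_{ij}`. It sends
`c_j` to the orthogonal projection to `U^⊥` of the derivative `∑_i X_{ij} b_{m+i}` of
`c_j` in the direction `X`; the dual frame `c_j^*` of `c_j` is the inner product with `b_j`. -/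
def dchart (b : OrthonormalBasis (Fin m ⊕ Fin n) ℂ (Amb m n)) (W X : Matrix (Fin n) (Fin m) ℂ) :
    (chart b W).tangent :=
  ∑ j, ((innerₛₗ ℂ (b (Sum.inl j))).comp (chart b W).taut.subtype).smulRight
    ((chart b W).perp.orthogonalProjectionOnto (∑ i, X i j • b (Sum.inr i)))

/-! ### Induced sesquilinear forms (linear in the first argument) -/

/-- The vector `a ∈ U` that represents `α ∈ U^*`, i.e. `α u = a^* u`. -/
def riesz (U : Gr m n) (α : Module.Dual ℂ U.taut) : U.taut :=
  (InnerProductSpace.toDual ℂ U.taut).symm (LinearMap.toContinuousLinearMap α)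

/-- The restriction to `U` of a sesquilinear form on `ℂ^{n+m}`, transported to `U^*` by the
Hermitian metric of `U`. -/
def dualForm (P : Amb m n → Amb m n → ℂ) (U : Gr m n) (α β : Module.Dual ℂ U.taut) : ℂ :=
  P (riesz U β) (riesz U α)

/-- The restriction to `U^⊥` of a sesquilinear form on `ℂ^{n+m}`. -/
def perpForm (P : Amb m n → Amb m n → ℂ) (U : Gr m n) (q r : U.perp) : ℂ :=
  P q r

/-- The sesquilinear form `P₁ · P₂` on `U^* ⊗ U^⊥ = Hom(U, U^⊥)` induced by sesquilinear forms on
the factors, `(P₁ · P₂)(α ⊗ q, β ⊗ r) = P₁(α, β) P₂(q, r)`. It is computed by writing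
`A = ∑ η_i^* ⊗ A η_i` with a basis `η_i` of `U`. -/
def mulForm (U : Gr m n) (P₁ : Module.Dual ℂ U.taut → Module.Dual ℂ U.taut → ℂ)
    (P₂ : U.perp → U.perp → ℂ) (A B : U.tangent) : ℂ :=
  let η := (stdOrthonormalBasis ℂ U.taut).toBasis
  ∑ i, ∑ j, P₁ (η.coord i) (η.coord j) * P₂ (A (η i)) (B (η j))

/-- The standard Hermitian form `v₂^* v₁`. -/
def euc (v₁ v₂ : Amb m n) : ℂ := inner ℂ v₂ v₁

/-- The sesquilinear form `P_γ(v₁, v₂) = v₂^* γ v₁`. -/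
def formP (γ : Matrix (Fin (n + m)) (Fin (n + m)) ℂ) (v₁ v₂ : Amb m n) : ℂ :=
  star v₂.ofLp ⬝ᵥ γ.mulVec v₁.ofLp

/-- The symmetric real tensor with complex components `h_{I J̄}`, for a Hermitian form `h` on the
holomorphic tangent space. As `h_{I J̄}` is the value of the complexified tensor on
`∂/∂w_I = (∂/∂x_I - √-1 ∂/∂y_I) / 2` and `∂/∂w̄_J`, the tensor is `2 Re h`. -/
def toReal (U : Gr m n) (h : U.tangent → U.tangent → ℂ) (A B : U.tangent) : ℝ :=
  2 * (h A B).re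

/-- The Fubini–Study metric `g = g₁ · g₂`, as a Riemannian metric. -/
def fubiniStudy (U : Gr m n) : U.tangent → U.tangent → ℝ :=
  toReal U (mulForm U (dualForm euc U) (perpForm euc U))

/-- The tensor `h₁`: the metric of `U^*` times the form that `P_γ` induces on `U^⊥`. -/
def h₁ (γ : Matrix (Fin (n + m)) (Fin (n + m)) ℂ) (U : Gr m n) : U.tangent → U.tangent → ℝ :=
  toReal U (mulForm U (dualForm euc U) (perpForm (formP γ) U))

/-- The tensor `h₂`: the form that `P_γ` induces on `U^*` times the metric of `U^⊥`. -/
def h₂ (γ : Matrix (Fin (n + m)) (Fin (n + m)) ℂ) (U : Gr m n) : U.tangent → U.tangent → ℝ :=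
  toReal U (mulForm U (dualForm (formP γ) U) (perpForm euc U))

/-- The function `f_γ(U) = ∑ P_γ(η_i, η_i)`, for an orthonormal basis `η_i` of `U` (the sum is real
for Hermitian `γ`, and does not depend on the basis). -/
def fγ (γ : Matrix (Fin (n + m)) (Fin (n + m)) ℂ) (U : Gr m n) : ℝ :=
  (∑ i, formP γ (stdOrthonormalBasis ℂ U.taut i : Amb m n)
    (stdOrthonormalBasis ℂ U.taut i : Amb m n)).re

/-- The Hessian of a function `f` on the Grassmannian with respect to the Levi-Civita connection of
the Fubini–Study metric, at the point with coordinates `W` in the chart of `b`, on the tangent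
vectors with coordinates `X`, `Y`. -/
def hess (f : Gr m n → ℝ) (b : OrthonormalBasis (Fin m ⊕ Fin n) ℂ (Amb m n))
    (W X Y : Matrix (Fin n) (Fin m) ℂ) : ℝ :=
  hessian (fun V A B => fubiniStudy (chart b V) (dchart b V A) (dchart b V B))
    (fun V => f (chart b V)) W X Y

end GrassmannHessian

end

/-!
Both sides are computed in the chart of `b` at an arbitrary point `W`. Write the vectors of `b` as
the columns of `(E₁ E₂)`, and put `C = E₁ + E₂ W` (a frame of the plane), `Q = E₂ - E₁ W^*` (a frame
of its orthogonal complement), with Gram matrices `H = I + W^* W` and `K = I + W W^*`.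

If the columns of `C R` form an orthonormal basis of the plane, then `R R^* = H⁻¹`
(`coeff_mul_ct`), and the tangent vector `X` maps them to the columns of `Q K⁻¹ X R`
(`colMat_dchart`). Hence every form of the shape `P₁ · P₂` is the trace of a product of matrices
(`mulForm_dchart`):
* `g(X, Y) = 2 Re tr (H⁻¹ Y^* K⁻¹ X)`,
* `h₁(X, Y) = 2 Re tr (H⁻¹ Y^* K⁻¹ (Q^* γ Q) K⁻¹ X)`,
* `h₂(X, Y) = 2 Re tr (H⁻¹ (C^* γ C) H⁻¹ Y^* K⁻¹ X)`,
* `f_γ = Re tr (H⁻¹ C^* γ C)`.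

The metric is Kähler, so Koszul's formula retains only the part of `X g(Y, Z)` that is complex
linear in `X` and `Y`, and gives `∇_X Y = -(Y H⁻¹ W^* X + X H⁻¹ W^* Y)` (`leviCivita_metricMat`).
The first derivative of `f_γ` is `Y f_γ = 2 Re tr (K⁻¹ Y H⁻¹ C^* γ Q)`. In its derivative in the
direction `X`, the terms linear in `X` are exactly `(∇_X Y) f_γ`. The terms conjugate linear in `X`
combine, by the identities `Q K⁻¹ = E₂ - C H⁻¹ W^*` and `C H⁻¹ = E₁ + Q K⁻¹ W`, into `h₁ - h₂`
(`hasLineDerivAt_gradMat`).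
-/

noncomputable section

namespace GrassmannHessian

open Matrix

/-! ### Entrywise derivatives of matrix-valued curves -/

section EntrywiseDerivative

variable {ι κ ν : Type*}

/-- The matrix-valued curve `F` has derivative `F'` at `t`, entry by entry. This avoids the choice
of a norm on rectangular matrices. -/
def HasMatrixDerivAt (F : ℝ → Matrix ι κ ℂ) (F' : Matrix ι κ ℂ) (t : ℝ) : Prop :=
  ∀ i j, HasDerivAt (fun s => F s i j) (F' i j) t

namespace HasMatrixDerivAt

theorem const (A : Matrix ι κ ℂ) (t : ℝ) : HasMatrixDerivAt (fun _ => A) 0 t :=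
  fun i j => hasDerivAt_const t (A i j)

theorem line (A B : Matrix ι κ ℂ) (t : ℝ) : HasMatrixDerivAt (fun s : ℝ => A + s • B) B t := by
  intro i j
  have h : HasDerivAt (fun s : ℝ => A i j + s • B i j) ((1 : ℝ) • B i j) t :=
    ((hasDerivAt_id t).smul_const (B i j)).const_add (A i j)
  simpa using h

theorem add {F G : ℝ → Matrix ι κ ℂ} {F' G' : Matrix ι κ ℂ} {t : ℝ}
    (hF : HasMatrixDerivAt F F' t) (hG : HasMatrixDerivAt G G' t) :
    HasMatrixDerivAt (fun s => F s + G s) (F' + G') t :=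
  fun i j => (hF i j).add (hG i j)

theorem sub {F G : ℝ → Matrix ι κ ℂ} {F' G' : Matrix ι κ ℂ} {t : ℝ}
    (hF : HasMatrixDerivAt F F' t) (hG : HasMatrixDerivAt G G' t) :
    HasMatrixDerivAt (fun s => F s - G s) (F' - G') t :=
  fun i j => (hF i j).sub (hG i j)

theorem mul [Fintype κ] {F : ℝ → Matrix ι κ ℂ} {G : ℝ → Matrix κ ν ℂ} {F' : Matrix ι κ ℂ}
    {G' : Matrix κ ν ℂ} {t : ℝ}
    (hF : HasMatrixDerivAt F F' t) (hG : HasMatrixDerivAt G G' t) :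
    HasMatrixDerivAt (fun s => F s * G s) (F' * G t + F t * G') t := by
  intro i j
  simp only [Matrix.add_apply, Matrix.mul_apply, ← Finset.sum_add_distrib]
  exact HasDerivAt.fun_sum fun k _ => (hF i k).mul (hG k j)

theorem conjTranspose {F : ℝ → Matrix ι κ ℂ} {F' : Matrix ι κ ℂ} {t : ℝ}
    (hF : HasMatrixDerivAt F F' t) : HasMatrixDerivAt (fun s => (F s)ᴴ) F'ᴴ t :=
  fun i j => (hF j i).star

theorem re_trace [Fintype ι] {F : ℝ → Matrix ι ι ℂ} {F' : Matrix ι ι ℂ} {t : ℝ}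
    (hF : HasMatrixDerivAt F F' t) :
    HasDerivAt (fun s => (trace (F s)).re) (trace F').re t := by
  have h : HasDerivAt (fun s => trace (F s)) (trace F') t :=
    HasDerivAt.fun_sum fun k _ => hF k k
  exact Complex.reCLM.hasFDerivAt.comp_hasDerivAt t h

section Inverse

attribute [local instance] Matrix.linftyOpNormedRing Matrix.linftyOpNormedAlgebra

/-- The entries of the inverse are differentiable because inversion is differentiable in the Banach
algebra of square matrices, with any submultiplicative norm. -/
theorem inv [Fintype ι] [DecidableEq ι] {F : ℝ → Matrix ι ι ℂ} {F' : Matrix ι ι ℂ} {t : ℝ}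
    (hF : HasMatrixDerivAt F F' t) (ht : IsUnit (F t)) :
    HasMatrixDerivAt (fun s => (F s)⁻¹) (-((F t)⁻¹ * F' * (F t)⁻¹)) t := by
  have h1 : HasDerivAt F F' t := by
    have h : HasDerivAt (fun s => ∑ i, ∑ j, F s i j • Matrix.single i j (1 : ℂ))
        (∑ i, ∑ j, F' i j • Matrix.single i j (1 : ℂ)) t :=
      HasDerivAt.fun_sum fun i _ => HasDerivAt.fun_sum fun j _ => (hF i j).smul_const _
    simpa only [Matrix.smul_single, smul_eq_mul, mul_one, ← Matrix.matrix_eq_sum_single] using h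
  obtain ⟨u, hu⟩ := ht
  have h2 := hasFDerivAt_ringInverse (𝕜 := ℝ) u
  rw [hu] at h2
  have h3 := h2.comp_hasDerivAt t h1
  intro i j
  have h4 :=
    (Matrix.entryLinearMap ℝ ℂ i j).toContinuousLinearMap.hasFDerivAt.comp_hasDerivAt t h3
  have hinv : (↑u⁻¹ : Matrix ι ι ℂ) = (F t)⁻¹ := by
    rw [← hu, Matrix.coe_units_inv]
  simp only [Function.comp_def, ← Matrix.nonsing_inv_eq_ringInverse, hinv] at h4
  exact h4

end Inverse

end HasMatrixDerivAt

end EntrywiseDerivative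


/-! ### Gram matrices and frames of a plane and of its complement -/

section MatrixModel

variable {ι κ μ : Type*} [Fintype ι] [Fintype κ] [Fintype μ] [DecidableEq ι] [DecidableEq κ]

/-- The Gram matrix `H = I + W^* W` of the frame `(I ; W)` of the plane with coordinates `W`. -/
def gramH (W : Matrix κ ι ℂ) : Matrix ι ι ℂ := 1 + Wᴴ * W

/-- The Gram matrix `K = I + W W^*` of the frame `(-W^* ; I)` of the orthogonal complement of the
plane with coordinates `W`. -/
def gramK (W : Matrix κ ι ℂ) : Matrix κ κ ℂ := 1 + W * Wᴴ

omit [DecidableEq κ] in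
open scoped ComplexOrder in
theorem isUnit_gramH (W : Matrix κ ι ℂ) : IsUnit (gramH W) :=
  (Matrix.PosDef.one.add_posSemidef (Matrix.posSemidef_conjTranspose_mul_self W)).isUnit

omit [DecidableEq ι] in
open scoped ComplexOrder in
theorem isUnit_gramK (W : Matrix κ ι ℂ) : IsUnit (gramK W) :=
  (Matrix.PosDef.one.add_posSemidef (Matrix.posSemidef_self_mul_conjTranspose W)).isUnit

omit [Fintype ι] [DecidableEq κ] in
theorem conjTranspose_gramH (W : Matrix κ ι ℂ) : (gramH W)ᴴ = gramH W := by
  simp [gramH, Matrix.conjTranspose_mul]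

omit [Fintype κ] [DecidableEq ι] in
theorem conjTranspose_gramK (W : Matrix κ ι ℂ) : (gramK W)ᴴ = gramK W := by
  simp [gramK, Matrix.conjTranspose_mul]

omit [DecidableEq κ] in
theorem gramH_mul_inv (W : Matrix κ ι ℂ) : gramH W * (gramH W)⁻¹ = 1 :=
  Matrix.mul_nonsing_inv _ ((Matrix.isUnit_iff_isUnit_det _).1 (isUnit_gramH W))

omit [DecidableEq ι] in
theorem gramK_mul_inv (W : Matrix κ ι ℂ) : gramK W * (gramK W)⁻¹ = 1 :=
  Matrix.mul_nonsing_inv _ ((Matrix.isUnit_iff_isUnit_det _).1 (isUnit_gramK W))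

omit [DecidableEq κ] in
theorem gramH_inv_mul (W : Matrix κ ι ℂ) : (gramH W)⁻¹ * gramH W = 1 :=
  Matrix.nonsing_inv_mul _ ((Matrix.isUnit_iff_isUnit_det _).1 (isUnit_gramH W))

omit [DecidableEq ι] in
theorem gramK_inv_mul (W : Matrix κ ι ℂ) : (gramK W)⁻¹ * gramK W = 1 :=
  Matrix.nonsing_inv_mul _ ((Matrix.isUnit_iff_isUnit_det _).1 (isUnit_gramK W))

omit [DecidableEq κ] in
theorem conjTranspose_gramH_inv (W : Matrix κ ι ℂ) : ((gramH W)⁻¹)ᴴ = (gramH W)⁻¹ := by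
  rw [Matrix.conjTranspose_nonsing_inv, conjTranspose_gramH]

omit [DecidableEq ι] in
theorem conjTranspose_gramK_inv (W : Matrix κ ι ℂ) : ((gramK W)⁻¹)ᴴ = (gramK W)⁻¹ := by
  rw [Matrix.conjTranspose_nonsing_inv, conjTranspose_gramK]

theorem gramK_mul_eq (W : Matrix κ ι ℂ) : gramK W * W = W * gramH W := by
  simp [gramK, gramH, Matrix.add_mul, Matrix.mul_add, Matrix.mul_assoc]

theorem gramK_inv_mul_eq (W : Matrix κ ι ℂ) : (gramK W)⁻¹ * W = W * (gramH W)⁻¹ := by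
  calc (gramK W)⁻¹ * W = (gramK W)⁻¹ * (W * gramH W) * (gramH W)⁻¹ := by
        rw [Matrix.mul_assoc, Matrix.mul_assoc W, gramH_mul_inv, Matrix.mul_one]
    _ = W * (gramH W)⁻¹ := by
        rw [← gramK_mul_eq, ← Matrix.mul_assoc, gramK_inv_mul, Matrix.one_mul]

theorem conjTranspose_mul_gramK_inv (W : Matrix κ ι ℂ) :
    Wᴴ * (gramK W)⁻¹ = (gramH W)⁻¹ * Wᴴ := by
  have h := congrArg Matrix.conjTranspose (gramK_inv_mul_eq W)
  simpa only [Matrix.conjTranspose_mul, conjTranspose_gramH_inv, conjTranspose_gramK_inv] using h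

/-- The frame `C = E₁ + E₂ W` of the plane with coordinates `W`, as a matrix of columns. The columns
of `E₁` and `E₂` are those of a unitary matrix in the application, but the calculus of
`hessian_metricMat_funMat` holds for all `E₁` and `E₂`. -/
def tautFrame (E₁ : Matrix μ ι ℂ) (E₂ : Matrix μ κ ℂ) (W : Matrix κ ι ℂ) : Matrix μ ι ℂ :=
  E₁ + E₂ * W

/-- The frame `Q = E₂ - E₁ W^*` of the orthogonal complement of the plane with coordinates `W`. -/
def perpFrame (E₁ : Matrix μ ι ℂ) (E₂ : Matrix μ κ ℂ) (W : Matrix κ ι ℂ) : Matrix μ κ ℂ :=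
  E₂ - E₁ * Wᴴ

omit [Fintype μ] in
/-- For unitary `(E₁ E₂)` this says that `Q K⁻¹` is the projection of `E₂` to the orthogonal
complement of the plane. -/
theorem perpFrame_mul_gramK_inv (E₁ : Matrix μ ι ℂ) (E₂ : Matrix μ κ ℂ) (W : Matrix κ ι ℂ) :
    perpFrame E₁ E₂ W * (gramK W)⁻¹ = E₂ - tautFrame E₁ E₂ W * (gramH W)⁻¹ * Wᴴ := by
  have h : E₂ * (gramK W)⁻¹ + E₂ * W * Wᴴ * (gramK W)⁻¹ = E₂ := by
    have h1 : E₂ * gramK W * (gramK W)⁻¹ = E₂ := by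
      rw [Matrix.mul_assoc, gramK_mul_inv, Matrix.mul_one]
    simpa only [gramK, Matrix.mul_add, Matrix.add_mul, Matrix.mul_one, Matrix.mul_assoc] using h1
  rw [Matrix.mul_assoc, ← conjTranspose_mul_gramK_inv, eq_sub_iff_add_eq]
  conv_rhs => rw [← h]
  simp only [perpFrame, tautFrame, Matrix.sub_mul, Matrix.add_mul, Matrix.mul_assoc]
  abel

omit [Fintype μ] in
/-- For unitary `(E₁ E₂)` this says that `C H⁻¹` is the projection of `E₁` to the plane. -/
theorem tautFrame_mul_gramH_inv (E₁ : Matrix μ ι ℂ) (E₂ : Matrix μ κ ℂ) (W : Matrix κ ι ℂ) :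
    tautFrame E₁ E₂ W * (gramH W)⁻¹ = E₁ + perpFrame E₁ E₂ W * (gramK W)⁻¹ * W := by
  have h : E₁ * (gramH W)⁻¹ + E₁ * Wᴴ * W * (gramH W)⁻¹ = E₁ := by
    have h1 : E₁ * gramH W * (gramH W)⁻¹ = E₁ := by
      rw [Matrix.mul_assoc, gramH_mul_inv, Matrix.mul_one]
    simpa only [gramH, Matrix.mul_add, Matrix.add_mul, Matrix.mul_one, Matrix.mul_assoc] using h1
  rw [Matrix.mul_assoc, gramK_inv_mul_eq]
  conv_rhs => enter [1]; rw [← h]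
  simp only [perpFrame, tautFrame, Matrix.sub_mul, Matrix.add_mul, Matrix.mul_assoc]
  abel

omit [DecidableEq ι] in
theorem re_trace_conjTranspose (A : Matrix ι ι ℂ) : (trace Aᴴ).re = (trace A).re := by
  rw [Matrix.trace_conjTranspose]
  simp

/-! ### Derivatives of the frames, of the metric and of the function -/

variable {V : ℝ → Matrix κ ι ℂ} {X : Matrix κ ι ℂ} {t : ℝ}

omit [DecidableEq κ] in
theorem HasMatrixDerivAt.gramH_inv (hV : HasMatrixDerivAt V X t) :
    HasMatrixDerivAt (fun s => (gramH (V s))⁻¹)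
      (-((gramH (V t))⁻¹ * (Xᴴ * V t + (V t)ᴴ * X) * (gramH (V t))⁻¹)) t := by
  have h := (HasMatrixDerivAt.const 1 t).add (hV.conjTranspose.mul hV)
  rw [zero_add] at h
  exact h.inv (isUnit_gramH (V t))

omit [DecidableEq ι] in
theorem HasMatrixDerivAt.gramK_inv (hV : HasMatrixDerivAt V X t) :
    HasMatrixDerivAt (fun s => (gramK (V s))⁻¹)
      (-((gramK (V t))⁻¹ * (X * (V t)ᴴ + V t * Xᴴ) * (gramK (V t))⁻¹)) t := by
  have h := (HasMatrixDerivAt.const 1 t).add (hV.mul hV.conjTranspose)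
  rw [zero_add] at h
  exact h.inv (isUnit_gramK (V t))

omit [Fintype ι] [Fintype μ] [DecidableEq ι] [DecidableEq κ] in
theorem HasMatrixDerivAt.tautFrame (E₁ : Matrix μ ι ℂ) (E₂ : Matrix μ κ ℂ)
    (hV : HasMatrixDerivAt V X t) :
    HasMatrixDerivAt (fun s => tautFrame E₁ E₂ (V s)) (E₂ * X) t := by
  have h := (HasMatrixDerivAt.const E₁ t).add ((HasMatrixDerivAt.const E₂ t).mul hV)
  simp only [Matrix.zero_mul, zero_add] at h
  exact h

omit [Fintype κ] [Fintype μ] [DecidableEq ι] [DecidableEq κ] in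
theorem HasMatrixDerivAt.perpFrame (E₁ : Matrix μ ι ℂ) (E₂ : Matrix μ κ ℂ)
    (hV : HasMatrixDerivAt V X t) :
    HasMatrixDerivAt (fun s => perpFrame E₁ E₂ (V s)) (-(E₁ * Xᴴ)) t := by
  have h := (HasMatrixDerivAt.const E₂ t).sub ((HasMatrixDerivAt.const E₁ t).mul hV.conjTranspose)
  simp only [Matrix.zero_mul, zero_add, zero_sub] at h
  exact h

/-- The Fubini–Study metric `2 Re tr (H⁻¹ B^* K⁻¹ A)` in the coordinates `W`. -/
def metricMat (W A B : Matrix κ ι ℂ) : ℝ :=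
  2 * (trace ((gramH W)⁻¹ * Bᴴ * (gramK W)⁻¹ * A)).re

/-- The function `f_γ` in the coordinates `W`: the real part of the trace of `γ` times the
projection `C H⁻¹ C^*` to the plane. -/
def funMat (γ : Matrix μ μ ℂ) (E₁ : Matrix μ ι ℂ) (E₂ : Matrix μ κ ℂ) (W : Matrix κ ι ℂ) : ℝ :=
  (trace ((gramH W)⁻¹ * ((tautFrame E₁ E₂ W)ᴴ * γ * tautFrame E₁ E₂ W))).re

/-- The derivative `2 Re tr (K⁻¹ Y H⁻¹ C^* γ Q)` of `funMat` in the direction `Y`, for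
Hermitian `γ`. -/
def gradMat (γ : Matrix μ μ ℂ) (E₁ : Matrix μ ι ℂ) (E₂ : Matrix μ κ ℂ) (W Y : Matrix κ ι ℂ) : ℝ :=
  2 * (trace ((gramK W)⁻¹ * Y * (gramH W)⁻¹ *
    ((tautFrame E₁ E₂ W)ᴴ * γ * perpFrame E₁ E₂ W))).re

/-- The first and third terms come from the part of the derivative that is complex linear in `X`,
the other two from the conjugate linear part. Written in this way, they show the symmetries
that collapse Koszul's formula to a single term. -/
theorem hasLineDerivAt_metricMat (W A B X : Matrix κ ι ℂ) :
    HasLineDerivAt ℝ (fun V => metricMat V A B)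
      (-2 * ((trace ((gramH W)⁻¹ * Wᴴ * X * (gramH W)⁻¹ * Bᴴ * (gramK W)⁻¹ * A)).re +
        (trace ((gramH W)⁻¹ * Wᴴ * X * (gramH W)⁻¹ * Aᴴ * (gramK W)⁻¹ * B)).re +
        (trace ((gramH W)⁻¹ * Wᴴ * A * (gramH W)⁻¹ * Bᴴ * (gramK W)⁻¹ * X)).re +
        (trace ((gramH W)⁻¹ * Wᴴ * B * (gramH W)⁻¹ * Aᴴ * (gramK W)⁻¹ * X)).re)) W X := by
  have hV := HasMatrixDerivAt.line W X 0
  have hd := (((hV.gramH_inv.mul (.const Bᴴ 0)).mul hV.gramK_inv).mul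
    (.const A 0)).re_trace.const_mul 2
  refine hd.congr_deriv ?_
  simp only [zero_smul, add_zero, Matrix.mul_zero]
  set h := (gramH W)⁻¹ with hh
  set k := (gramK W)⁻¹ with hk
  have hWk : Wᴴ * k = h * Wᴴ := conjTranspose_mul_gramK_inv W
  have hh' : hᴴ = h := conjTranspose_gramH_inv W
  have hk' : kᴴ = k := conjTranspose_gramK_inv W
  have e2 : (trace (h * Wᴴ * X * h * Aᴴ * k * B)).re =
      (trace (h * Xᴴ * W * h * Bᴴ * k * A)).re := by
    rw [← re_trace_conjTranspose]
    simpa only [Matrix.conjTranspose_mul, Matrix.conjTranspose_conjTranspose, hh', hk',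
      Matrix.mul_assoc] using
      congrArg Complex.re (Matrix.trace_mul_comm (Bᴴ * k * A) (h * Xᴴ * W * h))
  have e3 : (trace (h * Wᴴ * A * h * Bᴴ * k * X)).re =
      (trace (h * Bᴴ * k * X * Wᴴ * k * A)).re := by
    rw [Matrix.mul_assoc _ Wᴴ k, hWk]
    simpa only [Matrix.mul_assoc] using
      congrArg Complex.re (Matrix.trace_mul_comm (h * Wᴴ * A) (h * Bᴴ * k * X))
  have e4 : (trace (h * Wᴴ * B * h * Aᴴ * k * X)).re =
      (trace (h * Bᴴ * k * W * Xᴴ * k * A)).re := by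
    rw [← hWk, ← re_trace_conjTranspose]
    simpa only [Matrix.conjTranspose_mul, Matrix.conjTranspose_conjTranspose, hh', hk',
      Matrix.mul_assoc] using
      congrArg Complex.re (Matrix.trace_mul_comm (Xᴴ * k * A) (h * Bᴴ * k * W))
  rw [e2, e3, e4]
  simp only [Matrix.mul_add, Matrix.add_mul, Matrix.neg_mul, Matrix.mul_neg, Matrix.mul_assoc,
    Matrix.trace_add, Matrix.trace_neg, Complex.add_re, Complex.neg_re]
  ring

theorem hasLineDerivAt_funMat {γ : Matrix μ μ ℂ} (hγ : γ.IsHermitian) (E₁ : Matrix μ ι ℂ)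
    (E₂ : Matrix μ κ ℂ) (W Y : Matrix κ ι ℂ) :
    HasLineDerivAt ℝ (funMat γ E₁ E₂) (gradMat γ E₁ E₂ W Y) W Y := by
  have hV := HasMatrixDerivAt.line W Y 0
  have hC := hV.tautFrame E₁ E₂
  have hd := (hV.gramH_inv.mul ((hC.conjTranspose.mul (.const γ 0)).mul hC)).re_trace
  refine hd.congr_deriv ?_
  simp only [zero_smul, add_zero, Matrix.mul_zero, gradMat]
  have hQ := perpFrame_mul_gramK_inv E₁ E₂ W
  set h := (gramH W)⁻¹ with hh
  set k := (gramK W)⁻¹ with hk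
  set C := tautFrame E₁ E₂ W
  set Q := perpFrame E₁ E₂ W
  have hh' : hᴴ = h := conjTranspose_gramH_inv W
  have e1 : (trace (k * Y * h * (Cᴴ * γ * Q))).re =
      (trace (h * Cᴴ * γ * E₂ * Y)).re - (trace (h * Wᴴ * Y * h * Cᴴ * γ * C)).re := by
    have h1 := Matrix.trace_mul_comm (k * Y) (h * (Cᴴ * γ * Q))
    have h2 : h * (Cᴴ * γ * Q) * (k * Y) =
        h * Cᴴ * γ * E₂ * Y - (h * Cᴴ * γ * C) * (h * Wᴴ * Y) := by
      have : h * (Cᴴ * γ * Q) * (k * Y) = h * Cᴴ * γ * (Q * k) * Y := by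
        simp only [Matrix.mul_assoc]
      rw [this, hQ]
      simp only [Matrix.mul_sub, Matrix.sub_mul, Matrix.mul_assoc]
    rw [Matrix.mul_assoc (k * Y), h1, h2, Matrix.trace_sub, Complex.sub_re,
      Matrix.trace_mul_comm (h * Cᴴ * γ * C)]
    simp only [Matrix.mul_assoc]
  have e2 : (trace (h * Yᴴ * W * h * Cᴴ * γ * C)).re =
      (trace (h * Wᴴ * Y * h * Cᴴ * γ * C)).re := by
    rw [← re_trace_conjTranspose]
    simpa only [Matrix.conjTranspose_mul, Matrix.conjTranspose_conjTranspose, hh', hγ.eq,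
      Matrix.mul_assoc] using
      congrArg Complex.re (Matrix.trace_mul_comm (Cᴴ * γ * C) (h * Wᴴ * Y * h))
  have e3 : (trace (h * (E₂ * Y)ᴴ * γ * C)).re = (trace (h * Cᴴ * γ * E₂ * Y)).re := by
    rw [← re_trace_conjTranspose]
    simpa only [Matrix.conjTranspose_mul, Matrix.conjTranspose_conjTranspose, hh', hγ.eq,
      Matrix.mul_assoc] using
      congrArg Complex.re (Matrix.trace_mul_comm (Cᴴ * γ * E₂ * Y) h)
  rw [e1]
  simp only [Matrix.mul_assoc] at e2 e3
  simp only [Matrix.mul_add, Matrix.add_mul, Matrix.neg_mul, Matrix.mul_assoc,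
    Matrix.trace_add, Matrix.trace_neg, Complex.add_re, Complex.neg_re, e2, e3]
  ring

/-- The Levi-Civita derivative `∇_X Y` of constant vector fields in the coordinates `W`. -/
def christoffelMat (W X Y : Matrix κ ι ℂ) : Matrix κ ι ℂ :=
  -(Y * (gramH W)⁻¹ * Wᴴ * X + X * (gramH W)⁻¹ * Wᴴ * Y)

/-- The second derivative of `funMat`: the derivative along `∇_X Y` plus the difference of the two
tensors. -/
theorem hasLineDerivAt_gradMat {γ : Matrix μ μ ℂ} (hγ : γ.IsHermitian) (E₁ : Matrix μ ι ℂ)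
    (E₂ : Matrix μ κ ℂ) (W X Y : Matrix κ ι ℂ) :
    HasLineDerivAt ℝ (fun V => gradMat γ E₁ E₂ V Y)
      (gradMat γ E₁ E₂ W (christoffelMat W X Y) +
        (2 * (trace ((gramH W)⁻¹ * Yᴴ * (gramK W)⁻¹ *
            ((perpFrame E₁ E₂ W)ᴴ * γ * perpFrame E₁ E₂ W) * (gramK W)⁻¹ * X)).re -
          2 * (trace ((gramH W)⁻¹ * ((tautFrame E₁ E₂ W)ᴴ * γ * tautFrame E₁ E₂ W) *
            (gramH W)⁻¹ * Yᴴ * (gramK W)⁻¹ * X)).re)) W X := by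
  have hV := HasMatrixDerivAt.line W X 0
  have hC := hV.tautFrame E₁ E₂
  have hQ := hV.perpFrame E₁ E₂
  have hd := (((hV.gramK_inv.mul (.const Y 0)).mul hV.gramH_inv).mul
    ((hC.conjTranspose.mul (.const γ 0)).mul hQ)).re_trace.const_mul 2
  refine hd.congr_deriv ?_
  simp only [zero_smul, add_zero, Matrix.mul_zero, gradMat, christoffelMat]
  have hQk := perpFrame_mul_gramK_inv E₁ E₂ W
  have hCh := tautFrame_mul_gramH_inv E₁ E₂ W
  set h := (gramH W)⁻¹ with hh
  set k := (gramK W)⁻¹ with hk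
  set C := tautFrame E₁ E₂ W
  set Q := perpFrame E₁ E₂ W
  have hWk : Wᴴ * k = h * Wᴴ := conjTranspose_mul_gramK_inv W
  have hh' : hᴴ = h := conjTranspose_gramH_inv W
  have hk' : kᴴ = k := conjTranspose_gramK_inv W
  have hkQ : k * Qᴴ = E₂ᴴ - W * h * Cᴴ := by
    simpa only [Matrix.conjTranspose_mul, Matrix.conjTranspose_sub,
      Matrix.conjTranspose_conjTranspose, hh', hk', Matrix.mul_assoc]
      using congrArg Matrix.conjTranspose hQk
  -- The terms that are antiholomorphic in `X` assemble into the two tensors.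
  have e1 : (trace (h * Yᴴ * k * (Qᴴ * γ * Q) * k * X)).re =
      (trace (k * Y * h * Xᴴ * E₂ᴴ * γ * Q)).re
        - (trace (k * Y * h * Xᴴ * W * h * Cᴴ * γ * Q)).re := by
    have h1 : (trace (h * Yᴴ * k * (Qᴴ * γ * Q) * k * X)).re =
        (trace (k * Y * h * Xᴴ * (k * Qᴴ) * γ * Q)).re := by
      rw [← re_trace_conjTranspose]
      simpa only [Matrix.conjTranspose_mul, Matrix.conjTranspose_conjTranspose, hh', hk', hγ.eq,
        Matrix.mul_assoc] using
        congrArg Complex.re (Matrix.trace_mul_comm (Xᴴ * k * Qᴴ * γ * Q) (k * Y * h))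
    rw [h1, hkQ, ← Complex.sub_re, ← Matrix.trace_sub]
    simp only [Matrix.mul_sub, Matrix.sub_mul, Matrix.mul_assoc]
  have e2 : (trace (h * (Cᴴ * γ * C) * h * Yᴴ * k * X)).re =
      (trace (k * Y * h * Cᴴ * γ * E₁ * Xᴴ)).re
        + (trace (k * W * Xᴴ * k * Y * h * Cᴴ * γ * Q)).re := by
    have h1 : (trace (h * (Cᴴ * γ * C) * h * Yᴴ * k * X)).re =
        (trace (k * Y * h * Cᴴ * γ * (C * h) * Xᴴ)).re := by
      rw [← re_trace_conjTranspose]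
      simpa only [Matrix.conjTranspose_mul, Matrix.conjTranspose_conjTranspose, hh', hk', hγ.eq,
        Matrix.mul_assoc] using
        congrArg Complex.re (Matrix.trace_mul_comm Xᴴ (k * Y * h * Cᴴ * γ * C * h))
    have h2 := Matrix.trace_mul_comm (k * W * Xᴴ) (k * Y * h * Cᴴ * γ * Q)
    simp only [Matrix.mul_assoc] at h2
    rw [h1, hCh]
    simp only [Matrix.mul_add, Matrix.add_mul, Matrix.mul_assoc, Matrix.trace_add, Complex.add_re,
      h2]
  -- The terms that are holomorphic in `X` are the derivative along `∇_X Y`.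
  have e3 : X * Wᴴ * k * Y = X * h * Wᴴ * Y := by
    rw [Matrix.mul_assoc X, hWk, Matrix.mul_assoc X h]
  rw [e1, e2]
  have e4 : k * (X * Wᴴ + W * Xᴴ) * k * Y =
      k * (X * h * Wᴴ * Y) + k * W * Xᴴ * k * Y := by
    rw [← e3]
    simp only [Matrix.mul_add, Matrix.add_mul, Matrix.mul_assoc]
  rw [Matrix.neg_mul, e4]
  simp only [Matrix.mul_add, Matrix.add_mul, Matrix.neg_mul, Matrix.mul_neg, Matrix.mul_assoc,
    Matrix.trace_add, Matrix.trace_neg, Complex.add_re, Complex.neg_re, Matrix.conjTranspose_mul,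
    neg_add]
  ring

/-! ### The Levi-Civita connection and the Hessian of the matrix model -/

theorem koszul_metricMat (W X Y Z : Matrix κ ι ℂ) :
    metricMat W (christoffelMat W X Y) Z = koszul metricMat W X Y Z := by
  rw [koszul, (hasLineDerivAt_metricMat W Y Z X).lineDeriv,
    (hasLineDerivAt_metricMat W X Z Y).lineDeriv, (hasLineDerivAt_metricMat W X Y Z).lineDeriv,
    metricMat, christoffelMat]
  set h := (gramH W)⁻¹ with hh
  set k := (gramK W)⁻¹ with hk
  have e (A B : Matrix κ ι ℂ) : trace (h * Wᴴ * A * h * Zᴴ * k * B) =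
      trace (h * Zᴴ * k * (B * h * Wᴴ * A)) := by
    simpa only [Matrix.mul_assoc] using
      Matrix.trace_mul_comm (h * Wᴴ * A) (h * Zᴴ * k * B)
  simp only [e, Matrix.mul_neg, Matrix.mul_add, Matrix.trace_neg, Matrix.trace_add, Complex.neg_re,
    Complex.add_re]
  ring

theorem metricMat_sub_left (W A A' B : Matrix κ ι ℂ) :
    metricMat W (A - A') B = metricMat W A B - metricMat W A' B := by
  simp only [metricMat, Matrix.mul_sub, Matrix.trace_sub, Complex.sub_re]
  ring

open scoped ComplexOrder in
theorem metricMat_nondegenerate {W A : Matrix κ ι ℂ} (hA : ∀ Z, metricMat W A Z = 0) : A = 0 := by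
  -- Against this vector, the metric is twice the squared Frobenius norm of `A`.
  have h := hA (gramK W * A * gramH W)
  have h1 : (gramH W)⁻¹ * (gramK W * A * gramH W)ᴴ * (gramK W)⁻¹ * A = Aᴴ * A := by
    rw [Matrix.conjTranspose_mul, Matrix.conjTranspose_mul, conjTranspose_gramH,
      conjTranspose_gramK, ← Matrix.mul_assoc, gramH_inv_mul, Matrix.one_mul,
      Matrix.mul_assoc Aᴴ, gramK_mul_inv, Matrix.mul_one]
  rw [metricMat, h1] at h
  have h2 : trace (Aᴴ * A) = 0 := by
    refine Complex.ext (by simpa using h) ?_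
    have h3 : star (trace (Aᴴ * A)) = trace (Aᴴ * A) := by
      rw [← Matrix.trace_conjTranspose]
      simp
    exact Complex.conj_eq_iff_im.1 h3
  exact Matrix.trace_conjTranspose_mul_self_eq_zero_iff.1 h2

theorem leviCivita_metricMat (W X Y : Matrix κ ι ℂ) :
    leviCivita metricMat W X Y = christoffelMat W X Y := by
  have h := Classical.epsilon_spec (p := fun N => ∀ Z, metricMat W N Z = koszul metricMat W X Y Z)
    ⟨_, koszul_metricMat W X Y⟩
  refine sub_eq_zero.1 (metricMat_nondegenerate (W := W) fun Z => ?_)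
  rw [metricMat_sub_left, koszul_metricMat, sub_eq_zero]
  exact h Z

theorem hessian_metricMat_funMat {γ : Matrix μ μ ℂ} (hγ : γ.IsHermitian) (E₁ : Matrix μ ι ℂ)
    (E₂ : Matrix μ κ ℂ) (W X Y : Matrix κ ι ℂ) :
    hessian metricMat (funMat γ E₁ E₂) W X Y =
      2 * (trace ((gramH W)⁻¹ * Yᴴ * (gramK W)⁻¹ *
          ((perpFrame E₁ E₂ W)ᴴ * γ * perpFrame E₁ E₂ W) * (gramK W)⁻¹ * X)).re -
        2 * (trace ((gramH W)⁻¹ * ((tautFrame E₁ E₂ W)ᴴ * γ * tautFrame E₁ E₂ W) *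
          (gramH W)⁻¹ * Yᴴ * (gramK W)⁻¹ * X)).re := by
  have h (V A : Matrix κ ι ℂ) := (hasLineDerivAt_funMat hγ E₁ E₂ V A).lineDeriv
  simp only [hessian, leviCivita_metricMat, h, (hasLineDerivAt_gradMat hγ E₁ E₂ W X Y).lineDeriv]
  ring

end MatrixModel
/-! ### The geometry of the Grassmannian in a chart -/

section Coordinates

variable {m n : ℕ} {σ τ : Type*}

/-- The matrix whose columns are the coordinates of the vectors `v j`. -/
def colMat (v : σ → Amb m n) : Matrix (Fin (n + m)) σ ℂ := Matrix.of fun k j => (v j).ofLp k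

theorem conjTranspose_colMat_mul_mul_colMat (γ : Matrix (Fin (n + m)) (Fin (n + m)) ℂ)
    (v : σ → Amb m n) (w : τ → Amb m n) (i : σ) (j : τ) :
    ((colMat v)ᴴ * γ * colMat w) i j = formP γ (w j) (v i) := by
  rw [Matrix.mul_assoc]
  simp [formP, colMat, Matrix.mul_apply, dotProduct, Matrix.mulVec]

theorem euc_eq_formP_one : (euc : Amb m n → Amb m n → ℂ) = formP 1 := by
  funext v w
  simp [euc, formP, EuclideanSpace.inner_eq_star_dotProduct, dotProduct_comm]

theorem conjTranspose_colMat_mul_colMat (v : σ → Amb m n) (w : τ → Amb m n) (i : σ) (j : τ) :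
    ((colMat v)ᴴ * colMat w) i j = inner ℂ (v i) (w j) := by
  have h := conjTranspose_colMat_mul_mul_colMat 1 v w i j
  rw [Matrix.mul_one, ← euc_eq_formP_one] at h
  exact h

theorem colMat_mul [Fintype σ] (v : σ → Amb m n) (A : Matrix σ τ ℂ) :
    colMat v * A = colMat fun j => ∑ i, A i j • v i := by
  ext k j
  simp [colMat, Matrix.mul_apply, mul_comm]

variable (b : OrthonormalBasis (Fin m ⊕ Fin n) ℂ (Amb m n)) (W : Matrix (Fin n) (Fin m) ℂ)

/-- The first `m` vectors of the basis `b`, as columns. -/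
def leftMat : Matrix (Fin (n + m)) (Fin m) ℂ := colMat fun j => b (Sum.inl j)

/-- The last `n` vectors of the basis `b`, as columns. -/
def rightMat : Matrix (Fin (n + m)) (Fin n) ℂ := colMat fun i => b (Sum.inr i)

theorem leftMat_ct_mul_leftMat : (leftMat b)ᴴ * leftMat b = 1 := by
  ext i j
  rw [leftMat, conjTranspose_colMat_mul_colMat, b.inner_eq_ite, Matrix.one_apply]
  simp

theorem rightMat_ct_mul_rightMat : (rightMat b)ᴴ * rightMat b = 1 := by
  ext i j
  rw [rightMat, conjTranspose_colMat_mul_colMat, b.inner_eq_ite, Matrix.one_apply]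
  simp

theorem leftMat_ct_mul_rightMat : (leftMat b)ᴴ * rightMat b = 0 := by
  ext i j
  rw [leftMat, rightMat, conjTranspose_colMat_mul_colMat, b.inner_eq_ite]
  simp

theorem rightMat_ct_mul_leftMat : (rightMat b)ᴴ * leftMat b = 0 := by
  ext i j
  rw [leftMat, rightMat, conjTranspose_colMat_mul_colMat, b.inner_eq_ite]
  simp

/-- The frame `C` of the plane `chart b W`, as columns. -/
abbrev chartTaut : Matrix (Fin (n + m)) (Fin m) ℂ := tautFrame (leftMat b) (rightMat b) W

/-- The frame `Q` of the orthogonal complement of `chart b W`, as columns. -/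
abbrev chartPerp : Matrix (Fin (n + m)) (Fin n) ℂ := perpFrame (leftMat b) (rightMat b) W

theorem colMat_frame : colMat (frame b W) = chartTaut b W := by
  ext k j
  simp [colMat, chartTaut, tautFrame, frame, leftMat, rightMat, Matrix.mul_apply, mul_comm]

theorem chartTaut_ct_mul_self : (chartTaut b W)ᴴ * chartTaut b W = gramH W := by
  simp only [chartTaut, tautFrame, gramH, Matrix.conjTranspose_add, Matrix.conjTranspose_mul,
    Matrix.add_mul, Matrix.mul_add, leftMat_ct_mul_leftMat, Matrix.mul_assoc,
    rightMat_ct_mul_leftMat, Matrix.mul_zero, add_zero]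
  rw [← Matrix.mul_assoc, leftMat_ct_mul_rightMat, ← Matrix.mul_assoc (rightMat b)ᴴ,
    rightMat_ct_mul_rightMat, Matrix.zero_mul, zero_add, Matrix.one_mul]

theorem chartPerp_ct_mul_self : (chartPerp b W)ᴴ * chartPerp b W = gramK W := by
  simp only [chartPerp, perpFrame, gramK, Matrix.conjTranspose_sub, Matrix.conjTranspose_mul,
    Matrix.sub_mul, Matrix.mul_sub, rightMat_ct_mul_rightMat, Matrix.mul_assoc,
    leftMat_ct_mul_rightMat, Matrix.mul_zero, Matrix.conjTranspose_conjTranspose]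
  rw [← Matrix.mul_assoc, rightMat_ct_mul_leftMat, ← Matrix.mul_assoc (leftMat b)ᴴ,
    leftMat_ct_mul_leftMat, Matrix.zero_mul, Matrix.one_mul, sub_zero, zero_sub, sub_neg_eq_add]

theorem chartTaut_ct_mul_chartPerp : (chartTaut b W)ᴴ * chartPerp b W = 0 := by
  simp only [chartTaut, chartPerp, tautFrame, perpFrame, Matrix.conjTranspose_add,
    Matrix.conjTranspose_mul, Matrix.add_mul, Matrix.mul_sub, Matrix.mul_assoc,
    leftMat_ct_mul_rightMat, rightMat_ct_mul_rightMat]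
  rw [← Matrix.mul_assoc, leftMat_ct_mul_leftMat, ← Matrix.mul_assoc (rightMat b)ᴴ,
    rightMat_ct_mul_leftMat]
  simp

theorem leftMat_ct_mul_chartTaut : (leftMat b)ᴴ * chartTaut b W = 1 := by
  rw [chartTaut, tautFrame, Matrix.mul_add, leftMat_ct_mul_leftMat, ← Matrix.mul_assoc,
    leftMat_ct_mul_rightMat, Matrix.zero_mul, add_zero]

/-- The standard orthonormal basis of the plane `U`, as columns. -/
def onbMat (U : Gr m n) : Matrix (Fin (n + m)) (Fin (Module.finrank ℂ U.taut)) ℂ :=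
  colMat fun i => (stdOrthonormalBasis ℂ U.taut i : Amb m n)

/-- The coordinates of a vector of the plane in the frame `C` are its inner products with the first
`m` vectors of `b`, because `E₁^* C = I`. -/
theorem onbMat_eq_chartTaut_mul :
    onbMat (chart b W) = chartTaut b W * ((leftMat b)ᴴ * onbMat (chart b W)) := by
  obtain ⟨R, hR⟩ : ∃ R : Matrix (Fin m) (Fin (Module.finrank ℂ (chart b W).taut)) ℂ,
      onbMat (chart b W) = chartTaut b W * R := by
    have h (i) : ∃ a : Fin m → ℂ, ∑ j, a j • frame b W j =
        (stdOrthonormalBasis ℂ (chart b W).taut i : Amb m n) :=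
      (Submodule.mem_span_range_iff_exists_fun ℂ).1
        (stdOrthonormalBasis ℂ (chart b W).taut i).2
    choose a ha using h
    refine ⟨Matrix.of fun j i => a i j, ?_⟩
    rw [← colMat_frame, colMat_mul, onbMat]
    simp [ha]
  have h : (leftMat b)ᴴ * onbMat (chart b W) = R := by
    rw [hR, ← Matrix.mul_assoc, leftMat_ct_mul_chartTaut, Matrix.one_mul]
  rw [h, ← hR]

theorem chartTaut_eq_onbMat_mul :
    chartTaut b W = onbMat (chart b W) * ((onbMat (chart b W))ᴴ * chartTaut b W) := by
  rw [← colMat_frame]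
  conv_rhs => enter [1]; rw [onbMat]
  rw [colMat_mul]
  congr 1
  funext j
  have hj : frame b W j ∈ (chart b W).taut := Submodule.subset_span ⟨j, rfl⟩
  have h := congrArg (Submodule.subtype _)
    ((stdOrthonormalBasis ℂ (chart b W).taut).sum_repr' ⟨frame b W j, hj⟩)
  rw [map_sum] at h
  simp only [map_smul, Submodule.subtype_apply, Submodule.coe_inner] at h
  simp only [onbMat, conjTranspose_colMat_mul_colMat]
  exact h.symm

/-- If `R` expresses an orthonormal basis of the plane in the frame `C`, then `R R^* = H⁻¹`; so
expressions in an orthonormal basis become expressions in the Gram matrix. -/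
theorem coeff_mul_ct :
    ((leftMat b)ᴴ * onbMat (chart b W)) * ((leftMat b)ᴴ * onbMat (chart b W))ᴴ = (gramH W)⁻¹ := by
  set M := onbMat (chart b W) with hM
  set R := (leftMat b)ᴴ * M with hR
  have hMR : M = chartTaut b W * R := onbMat_eq_chartTaut_mul b W
  have h1 : chartTaut b W = chartTaut b W * (R * Rᴴ * gramH W) := by
    conv_lhs => rw [chartTaut_eq_onbMat_mul, ← hM, hMR]
    simp only [Matrix.conjTranspose_mul, Matrix.mul_assoc, chartTaut_ct_mul_self]
  have h2 : R * Rᴴ * gramH W = 1 := by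
    have h := congrArg ((leftMat b)ᴴ * ·) h1
    simp only [← Matrix.mul_assoc (leftMat b)ᴴ, leftMat_ct_mul_chartTaut, Matrix.one_mul] at h
    exact h.symm
  exact (Matrix.inv_eq_left_inv h2).symm

theorem coe_orthogonalProjectionOnto_perp (x : Fin n → ℂ) :
    ((chart b W).perp.orthogonalProjectionOnto (∑ i, x i • b (Sum.inr i)) : Amb m n) =
      WithLp.toLp 2 ((chartPerp b W * (gramK W)⁻¹) *ᵥ x) := by
  have hsum {σ : Type} [Fintype σ] (v : σ → Amb m n) (a : σ → ℂ) :
      ∑ i, a i • v i = WithLp.toLp 2 (colMat v *ᵥ a) := by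
    ext k
    simp [colMat, Matrix.mulVec, dotProduct, mul_comm]
  rw [← Submodule.starProjection_apply (chart b W).perp]
  refine Submodule.eq_starProjection_of_mem_orthogonal (K := (chart b W).perp) ?_ ?_
  · rw [Submodule.mem_orthogonal]
    intro u hu
    obtain ⟨a, rfl⟩ := (Submodule.mem_span_range_iff_exists_fun ℂ).1 hu
    rw [sum_inner]
    refine Finset.sum_eq_zero fun j _ => ?_
    rw [inner_smul_left]
    have h : inner ℂ (frame b W j) (WithLp.toLp 2 ((chartPerp b W * (gramK W)⁻¹) *ᵥ x) : Amb m n)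
        = ((chartTaut b W)ᴴ *ᵥ ((chartPerp b W * (gramK W)⁻¹) *ᵥ x)) j := by
      rw [← colMat_frame]
      simp [EuclideanSpace.inner_eq_star_dotProduct, Matrix.mulVec, dotProduct, colMat, mul_comm]
    rw [h, Matrix.mulVec_mulVec, ← Matrix.mul_assoc, chartTaut_ct_mul_chartPerp]
    simp
  · refine Submodule.le_orthogonal_orthogonal _ ?_
    have h : (∑ i, x i • b (Sum.inr i)) - WithLp.toLp 2 ((chartPerp b W * (gramK W)⁻¹) *ᵥ x) =
        ∑ j, (((gramH W)⁻¹ * Wᴴ) *ᵥ x) j • frame b W j := by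
      rw [hsum, hsum, colMat_frame, ← WithLp.toLp_sub, ← Matrix.sub_mulVec, Matrix.mulVec_mulVec,
        chartPerp, perpFrame_mul_gramK_inv, ← Matrix.mul_assoc]
      change WithLp.toLp 2 ((rightMat b - _) *ᵥ x) = _
      rw [sub_sub_cancel]
    rw [h]
    exact Submodule.sum_mem _ fun j _ => Submodule.smul_mem _ _ (Submodule.subset_span ⟨j, rfl⟩)

/-- The tangent vector with coordinates `X` sends an orthonormal basis of the plane, with matrix
`C R`, to the columns of `Q K⁻¹ X R`. -/
theorem colMat_dchart (X : Matrix (Fin n) (Fin m) ℂ) :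
    (colMat fun i => (dchart b W X (stdOrthonormalBasis ℂ (chart b W).taut i) : Amb m n)) =
      chartPerp b W * (gramK W)⁻¹ * X * ((leftMat b)ᴴ * onbMat (chart b W)) := by
  ext k i
  have h (j : Fin m) := coe_orthogonalProjectionOnto_perp b W (fun i => X i j)
  simp only [colMat, dchart, LinearMap.sum_apply, Submodule.coe_sum, Matrix.of_apply,
    LinearMap.smulRight_apply, Submodule.coe_smul, h, leftMat, onbMat]
  rw [Matrix.mul_apply]
  simp only [← colMat.eq_def, conjTranspose_colMat_mul_colMat]
  simp [Matrix.mul_apply, Matrix.mulVec, dotProduct, mul_comm]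

theorem riesz_coord (U : Gr m n) (i) :
    riesz U ((stdOrthonormalBasis ℂ U.taut).toBasis.coord i) = stdOrthonormalBasis ℂ U.taut i := by
  rw [riesz, LinearIsometryEquiv.symm_apply_eq]
  ext u
  simp [OrthonormalBasis.repr_apply_apply]

theorem mulForm_formP (γ₁ γ₂ : Matrix (Fin (n + m)) (Fin (n + m)) ℂ) (U : Gr m n)
    (A B : U.tangent) :
    mulForm U (dualForm (formP γ₁) U) (perpForm (formP γ₂) U) A B =
      trace (((onbMat U)ᴴ * γ₁ * onbMat U) *
        ((colMat fun i => (B (stdOrthonormalBasis ℂ U.taut i) : Amb m n))ᴴ * γ₂ *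
          colMat fun i => (A (stdOrthonormalBasis ℂ U.taut i) : Amb m n))) := by
  simp only [mulForm, dualForm, perpForm, riesz_coord, OrthonormalBasis.coe_toBasis, Matrix.trace,
    Matrix.diag_apply]
  refine Finset.sum_congr rfl fun i _ => ?_
  rw [Matrix.mul_apply]
  refine Finset.sum_congr rfl fun j _ => ?_
  rw [onbMat, conjTranspose_colMat_mul_mul_colMat, conjTranspose_colMat_mul_mul_colMat]

/-- The product forms in coordinates. The metric and the tensors `h₁`, `h₂` are the cases in which
`γ₁` or `γ₂` is the identity. -/
theorem mulForm_dchart (γ₁ γ₂ : Matrix (Fin (n + m)) (Fin (n + m)) ℂ)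
    (X Y : Matrix (Fin n) (Fin m) ℂ) :
    mulForm (chart b W) (dualForm (formP γ₁) (chart b W)) (perpForm (formP γ₂) (chart b W))
        (dchart b W X) (dchart b W Y) =
      trace ((gramH W)⁻¹ * ((chartTaut b W)ᴴ * γ₁ * chartTaut b W) * (gramH W)⁻¹ * Yᴴ *
        (gramK W)⁻¹ * ((chartPerp b W)ᴴ * γ₂ * chartPerp b W) * (gramK W)⁻¹ * X) := by
  rw [mulForm_formP, colMat_dchart, colMat_dchart]
  have hM := onbMat_eq_chartTaut_mul b W
  have hRR := coeff_mul_ct b W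
  set R := (leftMat b)ᴴ * onbMat (chart b W)
  rw [hM]
  set C := chartTaut b W
  set Q := chartPerp b W
  set S := Cᴴ * γ₁ * C * (R * Rᴴ) * Yᴴ * (gramK W)⁻¹ * (Qᴴ * γ₂ * Q) * (gramK W)⁻¹ * X with hS
  have h := Matrix.trace_mul_comm Rᴴ (S * R)
  rw [Matrix.mul_assoc S, Matrix.trace_mul_comm S, hS] at h
  rw [← hRR]
  simpa only [Matrix.conjTranspose_mul, conjTranspose_gramK_inv, Matrix.mul_assoc] using h

theorem fubiniStudy_dchart (X Y : Matrix (Fin n) (Fin m) ℂ) :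
    fubiniStudy (chart b W) (dchart b W X) (dchart b W Y) = metricMat W X Y := by
  rw [fubiniStudy, toReal, euc_eq_formP_one, mulForm_dchart, metricMat]
  simp only [Matrix.mul_one, chartTaut_ct_mul_self, chartPerp_ct_mul_self]
  rw [gramH_inv_mul, Matrix.one_mul, Matrix.mul_assoc _ (gramK W)⁻¹ (gramK W), gramK_inv_mul,
    Matrix.mul_one]

theorem h₁_dchart (γ : Matrix (Fin (n + m)) (Fin (n + m)) ℂ) (X Y : Matrix (Fin n) (Fin m) ℂ) :
    h₁ γ (chart b W) (dchart b W X) (dchart b W Y) =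
      2 * (trace ((gramH W)⁻¹ * Yᴴ * (gramK W)⁻¹ *
        ((chartPerp b W)ᴴ * γ * chartPerp b W) * (gramK W)⁻¹ * X)).re := by
  rw [h₁, toReal, euc_eq_formP_one, mulForm_dchart, Matrix.mul_one, chartTaut_ct_mul_self,
    gramH_inv_mul, Matrix.one_mul]

theorem h₂_dchart (γ : Matrix (Fin (n + m)) (Fin (n + m)) ℂ) (X Y : Matrix (Fin n) (Fin m) ℂ) :
    h₂ γ (chart b W) (dchart b W X) (dchart b W Y) =
      2 * (trace ((gramH W)⁻¹ * ((chartTaut b W)ᴴ * γ * chartTaut b W) *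
        (gramH W)⁻¹ * Yᴴ * (gramK W)⁻¹ * X)).re := by
  rw [h₂, toReal, euc_eq_formP_one, mulForm_dchart, Matrix.mul_one, chartPerp_ct_mul_self,
    Matrix.mul_assoc _ (gramK W)⁻¹ (gramK W), gramK_inv_mul, Matrix.mul_one]

theorem fγ_chart (γ : Matrix (Fin (n + m)) (Fin (n + m)) ℂ) :
    fγ γ (chart b W) = funMat γ (leftMat b) (rightMat b) W := by
  have h : ∑ i, formP γ (stdOrthonormalBasis ℂ (chart b W).taut i : Amb m n)
      (stdOrthonormalBasis ℂ (chart b W).taut i : Amb m n) =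
      trace ((onbMat (chart b W))ᴴ * γ * onbMat (chart b W)) := by
    simp only [Matrix.trace, Matrix.diag_apply, onbMat, conjTranspose_colMat_mul_mul_colMat]
  have hM := onbMat_eq_chartTaut_mul b W
  have hRR := coeff_mul_ct b W
  rw [fγ, h, funMat, ← hRR]
  set R := (leftMat b)ᴴ * onbMat (chart b W)
  rw [hM]
  have h2 := Matrix.trace_mul_comm Rᴴ ((chartTaut b W)ᴴ * γ * chartTaut b W * R)
  rw [Matrix.mul_assoc _ R, Matrix.trace_mul_comm _ (R * Rᴴ)] at h2
  simpa only [Matrix.conjTranspose_mul, Matrix.mul_assoc] using congrArg Complex.re h2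

end Coordinates

end GrassmannHessian

end

theorem lemma3p6 (m n : ℕ) (γ : Matrix (Fin (n + m)) (Fin (n + m)) ℂ)
    (hγ : γ.IsHermitian) (htr : γ.trace = 0)
    (b : OrthonormalBasis (Fin m ⊕ Fin n) ℂ (GrassmannHessian.Amb m n))
    (W X Y : Matrix (Fin n) (Fin m) ℂ) :
    GrassmannHessian.hess (GrassmannHessian.fγ γ) b W X Y =
      GrassmannHessian.h₁ γ (GrassmannHessian.chart b W)
          (GrassmannHessian.dchart b W X) (GrassmannHessian.dchart b W Y) -
        GrassmannHessian.h₂ γ (GrassmannHessian.chart b W)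
          (GrassmannHessian.dchart b W X) (GrassmannHessian.dchart b W Y) := by
  simp only [GrassmannHessian.hess, GrassmannHessian.fubiniStudy_dchart,
    GrassmannHessian.fγ_chart, GrassmannHessian.h₁_dchart, GrassmannHessian.h₂_dchart]
  exact GrassmannHessian.hessian_metricMat_funMat hγ _ _ W X Y
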